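/- For a permutation $\pi$ of $[n]=\{1,\dots,n\}$ let $\mathrm{exc}(\pi)$ be the number of $i\in[n]$ with $\pi(i)>i$, let $D_n$ be the set of derangements of $[n]$ (permutations with $\pi(i)\neq i$ for all $i$), and let $d_n(q)=\sum_{\pi\in D_n}q^{\mathrm{exc}(\pi)}\in\mathbb{R}[q]$ for $n\ge 0$ (so $d_0=1$, $d_1=0$, $d_2=q$). A real polynomial is called standard if it is zero or has positive leading coefficient; it is said to have only real zeros if it is zero (by convention) or all its complex zeros are real. For nonzero real polynomials $f,g$ with only real zeros, let $r_1\ge r_2\ge\cdots$ and $s_1\ge s_2\ge\cdots$ be the zeros of $f$ and $g$, listed with multiplicity. Say that $g$ alternates left of $f$ if $\deg f=\deg g=n$ and $s_n\le r_n\le s_{n-1}\le\cdots\le s_1\le r_1$, and that $g$ interlaces $f$ if $\deg f=\deg g+1=n$ and $r_n\le s_{n-1}\le\cdots\le r_2\le s_1\le r_1$. Write $g\preceq f$ if $g$ alternates left of $f$ or $g$ interlaces $f$; by convention also $a\preceq bx+c$ for all real constants $a,b,c$, and $f\preceq 0$ and $0\preceq f$ for every real polynomial $f$ with only real zeros. A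 sequence $(P_n)_{n\ge 0}$ of standard polynomials is a generalized Sturm sequence if every $P_n$ has only real zeros and $P_0\preceq P_1\preceq P_2\preceq\cdots$. Then: 1. for all $n\ge 2$, $$d_n(q)=(n-1)q\,d_{n-1}(q)+q(1-q)\,d_{n-1}'(q)+(n-1)q\,d_{n-2}(q);$$ 2. for all $n\ge 1$, $d_n(q)$ has only real zeros; 3. $(d_n(q))_{n\ge 0}$ is a generalized Sturm sequence. -/

import Mathlib

open Polynomial

/-- The number of excedances of a permutation `π`: indices `i` with `π i > i`. -/
def exc {n : ℕ} (π : Equiv.Perm (Fin n)) : ℕ :=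
  (Finset.univ.filter fun i : Fin n => i < π i).card

/-- The derangement polynomial `d_n(q) = ∑ q ^ exc(π)`, summed over the derangements `π` of an
`n`-element linearly ordered set. -/
noncomputable def derangementPoly (n : ℕ) : ℝ[X] :=
  ∑ π : derangements (Fin n), X ^ exc (π : Equiv.Perm (Fin n))

/-- A real polynomial is standard if it is zero or its leading coefficient is positive. -/
def IsStandard (p : ℝ[X]) : Prop := p = 0 ∨ 0 < p.leadingCoeff

/-- The class `RZ` of real polynomials all of whose complex zeros are real.
By convention the zero polynomial belongs to it. -/
def HasOnlyRealZeros (p : ℝ[X]) : Prop :=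
  p = 0 ∨ ∀ z : ℂ, aeval z p = 0 → z.im = 0

/-- The `i`-th real zero (`i = 0, 1, …`) of `p`, the zeros being listed with multiplicity in
nonincreasing order.  (Only used for `i` below the degree of a polynomial in `RZ`.) -/
noncomputable def nthZero (p : ℝ[X]) (i : ℕ) : ℝ :=
  (p.roots.sort (· ≥ ·)).getD i 0

/-- `g` alternates left of `f`: both are nonzero, have only real zeros and the same degree `n`, and
`s_n ≤ r_n ≤ s_{n-1} ≤ ⋯ ≤ s_1 ≤ r_1`, where `r_i`, `s_i` are the zeros of `f`, `g`. -/
def Alternates (g f : ℝ[X]) : Prop :=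
  g ≠ 0 ∧ f ≠ 0 ∧ HasOnlyRealZeros g ∧ HasOnlyRealZeros f ∧
  f.natDegree = g.natDegree ∧
  (∀ i < f.natDegree, nthZero g i ≤ nthZero f i) ∧
  (∀ i, i + 1 < f.natDegree → nthZero f (i + 1) ≤ nthZero g i)

/-- `g` interlaces `f`: both are nonzero and have only real zeros, `deg f = deg g + 1 = n`, and
`r_n ≤ s_{n-1} ≤ ⋯ ≤ s_2 ≤ r_2 ≤ s_1 ≤ r_1`, where `r_i`, `s_i` are the zeros of `f`, `g`. -/
def Interlaces (g f : ℝ[X]) : Prop :=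
  g ≠ 0 ∧ f ≠ 0 ∧ HasOnlyRealZeros g ∧ HasOnlyRealZeros f ∧
  f.natDegree = g.natDegree + 1 ∧
  (∀ i < g.natDegree, nthZero g i ≤ nthZero f i ∧ nthZero f (i + 1) ≤ nthZero g i)

/-- The relation `g ⪯ f`: `g` alternates left of `f` or `g` interlaces `f`, with the conventions
`a ⪯ b x + c` for real constants `a, b, c`, and `f ⪯ 0`, `0 ⪯ f` for `f` with only real zeros. -/
def Preceq (g f : ℝ[X]) : Prop :=
  Alternates g f ∨ Interlaces g f ∨
  (∃ a b c : ℝ, g = C a ∧ f = C b * X + C c) ∨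
  (HasOnlyRealZeros g ∧ f = 0) ∨ (g = 0 ∧ HasOnlyRealZeros f)

/-- A generalized Sturm sequence: standard polynomials with only real zeros such that
`P_0 ⪯ P_1 ⪯ P_2 ⪯ ⋯`. -/
def IsGeneralizedSturmSequence (P : ℕ → ℝ[X]) : Prop :=
  (∀ n, IsStandard (P n)) ∧ (∀ n, HasOnlyRealZeros (P n)) ∧ ∀ n, Preceq (P n) (P (n + 1))

/-! ### The recurrence -/

/-! Recurrence: removing the smallest point `0` from its cycle turns a derangement `π` into a
permutation `σ` of one point fewer, together with `a`, where `π 0 = a.succ`. Either `σ` is a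
derangement, or `a` is its only fixed point. The first case gives the terms in `d_{n-1}` and its
derivative, the second gives `(n-1) q d_{n-2}`.

Real zeros: write `d_{n+2} = q e_n` with `e_n` monic of degree `n` and `e_n(0) = 1`. By induction
the zeros of `e_n` and `e_{n+1}` are negative, simple and strictly interlacing
(`exists_interlacing_zeros`). At a zero of `e_{n+1}` the recurrence leaves only the terms in
`e_{n+1}'` and `e_n`, which have equal signs, so `e_{n+2}` alternates along these zeros. Its signs
at `0` and far to the left supply the two outer zeros. Multiplying by `q` makes the interlacing weak
at `0` only. -/

theorem exc_eq_sum {n : ℕ} (π : Equiv.Perm (Fin n)) :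
    exc π = ∑ i, if i < π i then 1 else 0 := by
  rw [exc, Finset.card_filter]

theorem derangementPoly_eq_sum (n : ℕ) :
    derangementPoly n =
      ∑ π : Equiv.Perm (Fin n), if ∀ i, π i ≠ i then X ^ exc π else 0 := by
  rw [derangementPoly, ← Finset.sum_filter]
  exact (Finset.sum_subtype (Finset.univ.filter fun π : Equiv.Perm (Fin n) => ∀ i, π i ≠ i)
    (p := (· ∈ derangements (Fin n))) (fun π => by simp [derangements])
    (fun π => (X : ℝ[X]) ^ exc π)).symm

/-- The arrow `j → a` of `σ` becomes `j → 0 → a`: `0` is a new excedance, `j` is no longer one, and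
all other arrows keep their status. -/
theorem exc_decomposeFin_symm {n : ℕ} (a : Fin n) (σ : Equiv.Perm (Fin n)) :
    exc (Equiv.Perm.decomposeFin.symm (a.succ, σ)) =
      1 + ∑ j, if j < σ j ∧ σ j ≠ a then 1 else 0 := by
  rw [exc_eq_sum, Fin.sum_univ_succ]
  refine congrArg₂ _ (by simp) (Finset.sum_congr rfl fun j _ => ?_)
  rw [Equiv.Perm.decomposeFin_symm_apply_succ]
  by_cases h : σ j = a
  · simp [h]
  · rw [Equiv.swap_apply_of_ne_of_ne (Fin.succ_ne_zero _) (by simpa using h)]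
    simp [h]

theorem forall_decomposeFin_symm_ne {n : ℕ} (a : Fin n) (σ : Equiv.Perm (Fin n)) :
    (∀ i, Equiv.Perm.decomposeFin.symm (a.succ, σ) i ≠ i) ↔ ∀ j, σ j = j → j = a := by
  rw [Fin.forall_fin_succ]
  simp only [Equiv.Perm.decomposeFin_symm_apply_zero, ne_eq, Fin.succ_ne_zero, not_false_eq_true,
    true_and, Equiv.Perm.decomposeFin_symm_apply_succ]
  refine forall_congr' fun j => ?_
  by_cases h : σ j = a
  · rw [h, Equiv.swap_apply_right]
    simp only [(Fin.succ_ne_zero j).symm, not_false_eq_true, true_iff]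
    exact Eq.symm
  · rw [Equiv.swap_apply_of_ne_of_ne (Fin.succ_ne_zero _) (by simpa using h), Fin.succ_inj]
    exact ⟨fun h1 h2 => absurd h2 h1, fun h1 h2 => h (h2.trans (h1 h2))⟩

theorem derangementPoly_succ_eq_sum (n : ℕ) :
    derangementPoly (n + 1) = ∑ a : Fin n, ∑ σ : Equiv.Perm (Fin n),
      if ∀ j, σ j = j → j = a then
        (X : ℝ[X]) ^ (1 + ∑ j, if j < σ j ∧ σ j ≠ a then 1 else 0) else 0 := by
  rw [derangementPoly_eq_sum, ← Equiv.Perm.decomposeFin.symm.sum_comp, Fintype.sum_prod_type,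
    Fin.sum_univ_succ, Finset.sum_eq_zero, zero_add]
  · refine Finset.sum_congr rfl fun a _ => Finset.sum_congr rfl fun σ _ => ?_
    simp only [forall_decomposeFin_symm_ne, exc_decomposeFin_symm]
  -- The first coordinate `0` means that `0` is fixed.
  · intro σ _
    rw [if_neg]
    exact fun h => h 0 (by simp)

/-- Permutations with `a` as unique fixed point are derangements of the other points. -/
theorem sum_fixedPoints_eq_singleton (m : ℕ) (a : Fin (m + 1)) :
    (∑ σ : Equiv.Perm (Fin (m + 1)), if ∀ j, σ j = j ↔ j = a then (X : ℝ[X]) ^ exc σ else 0) =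
      derangementPoly m := by
  let e : derangements (Fin m) ≃
      { f : Equiv.Perm (Fin (m + 1)) // ∀ x, ¬ x ≠ a ↔ x ∈ Function.fixedPoints f } :=
    (finSuccAboveEquiv a).derangementsCongr.trans (derangements.subtypeEquiv (· ≠ a))
  have he : ∀ (τ : derangements (Fin m)) (i : Fin m),
      (e τ).1 (a.succAbove i) = a.succAbove (τ.1 i) := by
    intro τ i
    have : (e τ).1 = Equiv.Perm.ofSubtype ((finSuccAboveEquiv a).permCongr τ.1) := rfl
    rw [this, Equiv.Perm.ofSubtype_apply_of_mem (p := (· ≠ a)) _ (Fin.succAbove_ne a i)]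
    have h : (⟨a.succAbove i, Fin.succAbove_ne a i⟩ : {x // x ≠ a}) = finSuccAboveEquiv a i := rfl
    rw [h, Equiv.permCongr_apply, Equiv.symm_apply_apply]
    rfl
  rw [← Finset.sum_filter, derangementPoly,
    Finset.sum_subtype (p := fun f : Equiv.Perm (Fin (m + 1)) =>
      ∀ x, ¬ x ≠ a ↔ x ∈ Function.fixedPoints f) _
      (fun σ => by simp [Function.IsFixedPt, iff_comm])]
  rw [← e.sum_comp]
  refine Finset.sum_congr rfl fun τ _ => ?_
  have ha : (e τ).1 a = a := ((e τ).2 a).mp (by simp)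
  congr 1
  rw [exc_eq_sum, exc_eq_sum, Fin.sum_univ_succAbove _ a]
  simp [ha, he]

/-- Inserting the new point into an excedance arrow keeps the count, and into any other arrow raises
it by one. With `e = exc σ` the sum is `e q^e + (n - e) q^(e+1)`. -/
theorem sum_excedances_erased {n : ℕ} (σ : Equiv.Perm (Fin n)) :
    (∑ a : Fin n, (X : ℝ[X]) ^ (1 + ∑ j, if j < σ j ∧ σ j ≠ a then 1 else 0)) =
      (n : ℝ[X]) * X * X ^ exc σ + X * (1 - X) * derivative (X ^ exc σ) := by
  rw [← Equiv.sum_comp σ]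
  have h1 : ∀ b, (1 + ∑ j, if j < σ j ∧ σ j ≠ σ b then 1 else 0) +
      (if b < σ b then 1 else 0) = exc σ + 1 := by
    intro b
    rw [exc_eq_sum, add_assoc, add_comm, ← Finset.sum_erase_add _ _ (Finset.mem_univ b),
      ← Finset.sum_erase_add (a := b) Finset.univ (fun i => if i < σ i then 1 else 0)
        (Finset.mem_univ b)]
    simp only [ne_eq, not_true_eq_false, and_false, if_false, add_zero]
    congr 2
    refine Finset.sum_congr rfl fun j hj => ?_
    simp [(Finset.mem_erase.mp hj).1]
  have h2 : ∀ b, (X : ℝ[X]) ^ (1 + ∑ j, if j < σ j ∧ σ j ≠ σ b then 1 else 0) =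
      X ^ (exc σ + 1) + (if b < σ b then 1 else 0) * (X ^ exc σ - X ^ (exc σ + 1)) := by
    intro b
    have := h1 b
    split_ifs at this ⊢
    · rw [Nat.add_right_cancel this]; ring
    · rw [add_zero] at this
      rw [this]; ring
  rw [Finset.sum_congr rfl fun b _ => h2 b, Finset.sum_add_distrib, ← Finset.sum_mul]
  have h3 : (∑ b, if b < σ b then (1 : ℝ[X]) else 0) = (exc σ : ℝ[X]) := by
    rw [exc_eq_sum]; push_cast; rfl
  rw [h3, derivative_X_pow]
  simp only [Finset.sum_const, Finset.card_univ, Fintype.card_fin, nsmul_eq_mul]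
  rcases exc σ with _ | k
  · simp
  · simp only [Nat.add_sub_cancel, map_natCast]; ring

theorem derangementPoly_recurrence (m : ℕ) :
    derangementPoly (m + 2) = ((m : ℝ[X]) + 1) * X * derangementPoly (m + 1)
      + X * (1 - X) * derivative (derangementPoly (m + 1))
      + ((m : ℝ[X]) + 1) * X * derangementPoly m := by
  -- The two summands separate the cases `σ a ≠ a` and `σ a = a`; in the latter, erasing the arrow
  -- into `a` loses no excedance.
  have hsplit : ∀ (a : Fin (m + 1)) (σ : Equiv.Perm (Fin (m + 1))),
      (if ∀ j, σ j = j → j = a then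
        (X : ℝ[X]) ^ (1 + ∑ j, if j < σ j ∧ σ j ≠ a then 1 else 0) else 0) =
      (if ∀ j, σ j ≠ j then
        (X : ℝ[X]) ^ (1 + ∑ j, if j < σ j ∧ σ j ≠ a then 1 else 0) else 0) +
      X * (if ∀ j, σ j = j ↔ j = a then X ^ exc σ else 0) := by
    intro a σ
    by_cases ha : σ a = a
    · have h1 : ¬ ∀ j, σ j ≠ j := fun h => h a ha
      have h2 : (∀ j, σ j = j ↔ j = a) ↔ ∀ j, σ j = j → j = a :=
        forall_congr' fun j => ⟨Iff.mp, fun h => ⟨h, by rintro rfl; exact ha⟩⟩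
      have h3 : (∑ j, if j < σ j ∧ σ j ≠ a then 1 else 0) = exc σ := by
        rw [exc_eq_sum]
        refine Finset.sum_congr rfl fun j _ => if_congr ?_ rfl rfl
        refine and_iff_left_of_imp fun hj hja => ?_
        rw [← ha, σ.injective.eq_iff] at hja
        subst hja
        exact absurd hj (by rw [ha]; exact lt_irrefl _)
      simp only [h1, h2, h3, if_false, zero_add, mul_ite, mul_zero]
      rw [pow_add, pow_one]
    · have h1 : (∀ j, σ j ≠ j) ↔ ∀ j, σ j = j → j = a :=
        forall_congr' fun j => ⟨fun h h' => absurd h' h, fun h h' => ha (h h' ▸ h')⟩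
      have h2 : ¬ ∀ j, σ j = j ↔ j = a := fun h => ha ((h a).mpr rfl)
      simp only [h1, h2, if_false, mul_zero, add_zero]
  rw [derangementPoly_succ_eq_sum]
  simp only [hsplit, Finset.sum_add_distrib, ← Finset.mul_sum, sum_fixedPoints_eq_singleton]
  rw [Finset.sum_comm]
  have hswap : ∀ σ : Equiv.Perm (Fin (m + 1)), (∑ a, if ∀ j, σ j ≠ j then
        (X : ℝ[X]) ^ (1 + ∑ j, if j < σ j ∧ σ j ≠ a then 1 else 0) else 0) =
      ((m : ℝ[X]) + 1) * X * (if ∀ j, σ j ≠ j then X ^ exc σ else 0) +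
        X * (1 - X) * derivative (if ∀ j, σ j ≠ j then X ^ exc σ else 0) := by
    intro σ
    split_ifs
    · rw [sum_excedances_erased]; push_cast; rfl
    · simp
  rw [Finset.sum_congr rfl fun σ _ => hswap σ, Finset.sum_add_distrib, ← Finset.mul_sum,
    ← Finset.mul_sum, ← derivative_sum, ← derangementPoly_eq_sum]
  simp
  ring

/-! ### Real-rootedness -/

/-- Each zero to the right of `x` contributes one negative factor. -/
theorem neg_one_pow_mul_prod_sub_pos (s : Finset ℕ) (f : ℕ → ℝ) (x : ℝ) (h : ∀ i ∈ s, f i ≠ x) :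
    0 < (-1 : ℝ) ^ (s.filter fun i => x < f i).card * ∏ i ∈ s, (x - f i) := by
  have h1 : (-1 : ℝ) ^ (s.filter fun i => x < f i).card =
      ∏ i ∈ s, (if x < f i then (-1 : ℝ) else 1) := by
    rw [Finset.prod_ite, Finset.prod_const, Finset.prod_const_one, mul_one]
  rw [h1, ← Finset.prod_mul_distrib]
  refine Finset.prod_pos fun i hi => ?_
  split_ifs with hx
  · linarith
  · have := lt_of_le_of_ne (not_lt.mp hx) (h i hi)
    linarith

/-- The monic polynomial with zeros `r 0, …, r (m - 1)`. -/
noncomputable def polyOfZeros (r : ℕ → ℝ) (m : ℕ) : ℝ[X] :=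
  ∏ i ∈ Finset.range m, (X - C (r i))

theorem polyOfZeros_monic (r : ℕ → ℝ) (m : ℕ) : (polyOfZeros r m).Monic :=
  monic_prod_of_monic _ _ fun i _ => monic_X_sub_C (r i)

theorem natDegree_polyOfZeros (r : ℕ → ℝ) (m : ℕ) : (polyOfZeros r m).natDegree = m := by
  rw [polyOfZeros, natDegree_prod_of_monic _ _ fun i _ => monic_X_sub_C (r i)]
  simp

theorem eval_polyOfZeros (r : ℕ → ℝ) (m : ℕ) (x : ℝ) :
    (polyOfZeros r m).eval x = ∏ i ∈ Finset.range m, (x - r i) := by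
  simp [polyOfZeros, eval_prod]

theorem eval_derivative_polyOfZeros (r : ℕ → ℝ) {m k : ℕ} (hk : k < m) :
    (derivative (polyOfZeros r m)).eval (r k) =
      ∏ i ∈ (Finset.range m).erase k, (r k - r i) := by
  have h : polyOfZeros r m = (X - C (r k)) * ∏ i ∈ (Finset.range m).erase k, (X - C (r i)) :=
    (Finset.mul_prod_erase _ _ (Finset.mem_range.mpr hk)).symm
  rw [h, derivative_mul]
  simp [eval_prod]

theorem hasOnlyRealZeros_polyOfZeros (r : ℕ → ℝ) (m : ℕ) :
    HasOnlyRealZeros (polyOfZeros r m) := by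
  refine Or.inr fun z hz => ?_
  simp only [polyOfZeros, map_prod, Finset.prod_eq_zero_iff, map_sub, aeval_X, aeval_C] at hz
  obtain ⟨i, -, hi⟩ := hz
  rw [sub_eq_zero.mp hi]
  exact Complex.ofReal_im _

theorem nthZero_polyOfZeros {r : ℕ → ℝ} {m : ℕ} (hr : ∀ i j, i < j → j < m → r j < r i)
    {i : ℕ} (hi : i < m) : nthZero (polyOfZeros r m) i = r i := by
  have h1 : (polyOfZeros r m).roots = (Multiset.range m).map r := by
    have h : polyOfZeros r m = (((Multiset.range m).map r).map fun a => X - C a).prod := by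
      rw [Multiset.map_map]; rfl
    rw [h, roots_multiset_prod_X_sub_C]
  have h2 : ∀ a ∈ Multiset.range m, ∀ b ∈ Multiset.range m, a ≤ b ↔ r a ≥ r b := by
    intro a ha b hb
    rw [Multiset.mem_range] at ha hb
    constructor
    · intro hab
      rcases hab.eq_or_lt with rfl | hab
      · exact le_rfl
      · exact (hr a b hab hb).le
    · intro hab
      by_contra hlt
      exact absurd (hr b a (not_le.mp hlt) ha) (not_lt.mpr hab)
  rw [nthZero, h1, ← Multiset.map_sort _ _ _ _ h2, Multiset.sort_range]
  simp [hi]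

theorem lt_of_forall_succ_lt {s : ℕ → ℝ} {m : ℕ} (h : ∀ i, i + 1 < m → s (i + 1) < s i) :
    ∀ i j, i < j → j < m → s j < s i := by
  intro i j hij
  induction j, hij using Nat.le_induction with
  | base => exact h i
  | succ j hj ih => exact fun hm => (h j hm).trans (ih (by omega))

/-- A monic polynomial of degree `m` that alternates in sign at `m + 1` decreasing points splits,
with one zero in each gap. -/
theorem exists_polyOfZeros_of_alternating {p : ℝ[X]} {m : ℕ} (hp : p.Monic)
    (hdeg : p.natDegree = m) (y : ℕ → ℝ) (hy : ∀ k < m, y (k + 1) < y k)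
    (hsign : ∀ k ≤ m, 0 < (-1 : ℝ) ^ k * p.eval (y k)) :
    ∃ t : ℕ → ℝ, (∀ k < m, y (k + 1) < t k ∧ t k < y k) ∧ p = polyOfZeros t m := by
  have hex : ∀ k, ∃ t, k < m → (y (k + 1) < t ∧ t < y k) ∧ p.eval t = 0 := by
    intro k
    by_cases hk : k < m
    · have h1 := hsign k hk.le
      have h2 := hsign (k + 1) hk
      have hc : ContinuousOn (fun x => (-1 : ℝ) ^ k * p.eval x) (Set.Icc (y (k + 1)) (y k)) := by
        fun_prop
      have h0 : (0 : ℝ) ∈ Set.Ioo ((-1 : ℝ) ^ k * p.eval (y (k + 1)))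
          ((-1 : ℝ) ^ k * p.eval (y k)) := ⟨by rw [pow_succ] at h2; linarith, h1⟩
      obtain ⟨t, ht, h⟩ := intermediate_value_Ioo (hy k hk).le hc h0
      refine ⟨t, fun _ => ⟨ht, ?_⟩⟩
      simpa using h
    · exact ⟨0, fun h => absurd h hk⟩
  choose t ht using hex
  refine ⟨t, fun k hk => (ht k hk).1, ?_⟩
  have hanti := lt_of_forall_succ_lt (s := t) (m := m) fun i hi =>
    (ht (i + 1) hi).1.2.trans (ht i (by omega)).1.1
  -- The zeros found are distinct, so their linear factors are coprime and the product divides `p`;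
  -- equal degrees then force equality.
  have hdvd : polyOfZeros t m ∣ p := by
    refine Finset.prod_dvd_of_coprime ?_ fun i hi => ?_
    · intro i hi j hj hij
      simp only [Finset.coe_range, Set.mem_Iio] at hi hj
      refine isCoprime_X_sub_C_of_isUnit_sub ?_
      rw [isUnit_iff_ne_zero, sub_ne_zero]
      rcases lt_or_gt_of_ne hij with h | h
      · exact (hanti i j h hj).ne'
      · exact (hanti j i h hi).ne
    · exact dvd_iff_isRoot.mpr (ht i (Finset.mem_range.mp hi)).2
  exact eq_of_monic_of_dvd_of_natDegree_le (polyOfZeros_monic t m) hp hdvd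
    (by rw [natDegree_polyOfZeros, hdeg])

theorem exists_lt_neg_one_pow_mul_eval_pos {p : ℝ[X]} (hp : p.Monic) (hdeg : 0 < p.natDegree)
    (a : ℝ) : ∃ x < a, 0 < (-1 : ℝ) ^ p.natDegree * p.eval x := by
  have h := hp.neg_one_pow_natDegree_mul_comp_neg_X
  -- Reflection turns behaviour at `-∞` into that of a monic polynomial at `+∞`.
  set q := (-1) ^ p.natDegree * p.comp (-X) with hq
  have hqd : q.natDegree = p.natDegree := by
    rw [hq, ← C_1, ← C_neg, ← C_pow, natDegree_C_mul (by simp), natDegree_comp]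
    simp
  have ht := q.tendsto_atTop_of_leadingCoeff_nonneg
    (natDegree_pos_iff_degree_pos.mp (hqd ▸ hdeg)) (by rw [h.leadingCoeff]; norm_num)
  obtain ⟨x, h1, h2⟩ := ((ht.eventually_gt_atTop 0).and
    (Filter.eventually_gt_atTop (-a))).exists
  refine ⟨-x, by linarith, ?_⟩
  simpa [hq] using h1

/-! ### The reduced polynomials and their strict interlacing -/

/-- The polynomials `e_n` with `d_{n+2} = q e_n`. -/
noncomputable def reducedDerangementPoly : ℕ → ℝ[X]
  | 0 => 1
  | 1 => 1 + X
  | n + 2 => (C ((n : ℝ) + 2) * X + 1) * reducedDerangementPoly (n + 1)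
      + X * (1 - X) * derivative (reducedDerangementPoly (n + 1))
      + C ((n : ℝ) + 3) * X * reducedDerangementPoly n

/-- In top degree, `n + 2` from the linear factor and `-(n + 1)` from `-X ^ 2` times the derivative
leave `1`; the last term has lower degree. -/
theorem coeff_reducedDerangementPoly (n : ℕ) :
    (reducedDerangementPoly n).coeff n = 1 ∧
      ∀ k, n < k → (reducedDerangementPoly n).coeff k = 0 := by
  induction n using Nat.twoStepInduction with
  | zero =>
    refine ⟨by simp [reducedDerangementPoly], fun k hk => ?_⟩
    simp [reducedDerangementPoly, coeff_one, hk.ne']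
  | one =>
    refine ⟨by simp [reducedDerangementPoly, coeff_one], fun k hk => ?_⟩
    simp [reducedDerangementPoly, coeff_one, coeff_X, hk.ne, (zero_lt_one.trans hk).ne']
  | more n ih1 ih2 =>
    have key : ∀ k, (reducedDerangementPoly (n + 2)).coeff (k + 2) =
        ((n : ℝ) + 1 - k) * (reducedDerangementPoly (n + 1)).coeff (k + 1)
        + ((k : ℝ) + 3) * (reducedDerangementPoly (n + 1)).coeff (k + 2)
        + ((n : ℝ) + 3) * (reducedDerangementPoly n).coeff (k + 1) := by
      intro k
      have hre : reducedDerangementPoly (n + 2) =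
          C ((n : ℝ) + 2) * (reducedDerangementPoly (n + 1) * X) + reducedDerangementPoly (n + 1)
          + derivative (reducedDerangementPoly (n + 1)) * X
          - derivative (reducedDerangementPoly (n + 1)) * X * X
          + C ((n : ℝ) + 3) * (reducedDerangementPoly n * X) := by
        rw [reducedDerangementPoly]; ring
      rw [hre]
      simp only [coeff_add, coeff_sub, coeff_C_mul, coeff_mul_X, coeff_derivative]
      push_cast
      ring
    refine ⟨?_, fun k hk => ?_⟩
    · rw [key, ih2.1, ih2.2 _ (by omega), ih1.2 _ (by omega)]
      ring
    · obtain ⟨k, rfl⟩ : ∃ j, k = j + 2 := ⟨k - 2, by omega⟩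
      rw [key, ih2.2 _ (by omega), ih2.2 _ (by omega), ih1.2 _ (by omega)]
      ring

theorem natDegree_reducedDerangementPoly (n : ℕ) : (reducedDerangementPoly n).natDegree = n :=
  natDegree_eq_of_le_of_coeff_ne_zero
    (natDegree_le_iff_coeff_eq_zero.mpr (coeff_reducedDerangementPoly n).2)
    (by rw [(coeff_reducedDerangementPoly n).1]; exact one_ne_zero)

theorem reducedDerangementPoly_monic (n : ℕ) : (reducedDerangementPoly n).Monic := by
  rw [Monic, leadingCoeff, natDegree_reducedDerangementPoly, (coeff_reducedDerangementPoly n).1]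

theorem eval_zero_reducedDerangementPoly (n : ℕ) : (reducedDerangementPoly n).eval 0 = 1 := by
  induction n using Nat.twoStepInduction with
  | zero => simp [reducedDerangementPoly]
  | one => simp [reducedDerangementPoly]
  | more n _ ih => simp [reducedDerangementPoly, ih]

theorem exists_interlacing_zeros (n : ℕ) : ∃ r s : ℕ → ℝ,
    reducedDerangementPoly n = polyOfZeros r n ∧
    reducedDerangementPoly (n + 1) = polyOfZeros s (n + 1) ∧ s 0 < 0 ∧
    ∀ i < n, s (i + 1) < r i ∧ r i < s i := by
  induction n with
  | zero =>
    refine ⟨fun _ => 0, fun _ => -1, by simp [reducedDerangementPoly, polyOfZeros], ?_,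
      by norm_num, by simp⟩
    simp [reducedDerangementPoly, polyOfZeros, add_comm]
  | succ n ih =>
    obtain ⟨r, s, hr, hs, hs0, hrs⟩ := ih
    have hanti := lt_of_forall_succ_lt (s := s) (m := n + 1) fun i hi =>
      (hrs i (by omega)).1.trans (hrs i (by omega)).2
    have hle : ∀ i j, i ≤ j → j < n + 1 → s j ≤ s i := fun i j hij hj => by
      rcases hij.eq_or_lt with rfl | h
      · exact le_rfl
      · exact (hanti i j h hj).le
    have hsneg : ∀ k < n + 1, s k < 0 := fun k hk => (hle 0 k k.zero_le hk).trans_lt hs0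
    have hd : ∀ k < n + 1,
        0 < (-1 : ℝ) ^ k * (derivative (reducedDerangementPoly (n + 1))).eval (s k) := by
      intro k hk
      rw [hs, eval_derivative_polyOfZeros s hk]
      have h := neg_one_pow_mul_prod_sub_pos ((Finset.range (n + 1)).erase k) s (s k) ?_
      · convert h using 3
        have : ((Finset.range (n + 1)).erase k).filter (fun i => s k < s i) = Finset.range k := by
          ext i
          simp only [Finset.mem_filter, Finset.mem_erase, Finset.mem_range]
          refine ⟨fun ⟨⟨h1, h2⟩, h3⟩ => ?_, fun hi => ⟨⟨hi.ne, hi.trans hk⟩, hanti i k hi hk⟩⟩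
          by_contra hki
          exact absurd (hle k i (not_lt.mp hki) h2) (not_le.mpr h3)
        rw [this, Finset.card_range]
      · intro i hi
        simp only [Finset.mem_erase, Finset.mem_range] at hi
        rcases lt_or_gt_of_ne hi.1 with h | h
        · exact (hanti i k h hk).ne'
        · exact (hanti k i h hi.2).ne
    have he : ∀ k < n + 1, 0 < (-1 : ℝ) ^ k * (reducedDerangementPoly n).eval (s k) := by
      intro k hk
      rw [hr, eval_polyOfZeros]
      have hlt : ∀ i < k, s k < r i := fun i hi =>
        (hle (i + 1) k hi hk).trans_lt (hrs i (by omega)).1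
      have hgt : ∀ i, k ≤ i → i < n → r i < s k := fun i hi hn =>
        (hrs i hn).2.trans_le (hle k i hi (by omega))
      have h := neg_one_pow_mul_prod_sub_pos (Finset.range n) r (s k) ?_
      · convert h using 3
        have : (Finset.range n).filter (fun i => s k < r i) = Finset.range k := by
          ext i
          simp only [Finset.mem_filter, Finset.mem_range]
          refine ⟨fun ⟨h1, h2⟩ => ?_, fun hi => ⟨by omega, hlt i hi⟩⟩
          by_contra hki
          exact absurd (hgt i (not_lt.mp hki) h1) (not_lt.mpr h2.le)
        rw [this, Finset.card_range]
      · intro i hi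
        rcases lt_or_ge i k with h | h
        · exact (hlt i h).ne'
        · exact (hgt i h (Finset.mem_range.mp hi)).ne
    obtain ⟨L, hL, hLpos⟩ := exists_lt_neg_one_pow_mul_eval_pos
      (reducedDerangementPoly_monic (n + 2))
      (by rw [natDegree_reducedDerangementPoly]; omega) (s n)
    rw [natDegree_reducedDerangementPoly] at hLpos
    -- Decreasing sample points `0, s 0, …, s n, L`: `n + 3` of them for degree `n + 2`.
    let y : ℕ → ℝ := fun k => if k = 0 then 0 else if k < n + 2 then s (k - 1) else L
    have hy0 : y 0 = 0 := by simp [y]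
    have hys : ∀ k < n + 1, y (k + 1) = s k := fun k hk => by
      simp [y, show k + 1 < n + 2 by omega]
    have hyL : y (n + 2) = L := by simp [y]
    have hy : ∀ k < n + 2, y (k + 1) < y k := by
      intro k hk
      rcases k with _ | k
      · rw [hy0, hys 0 (by omega)]
        exact hs0
      · rw [hys k (by omega)]
        rcases Nat.lt_or_ge (k + 1) (n + 1) with h | h
        · rw [hys _ h]
          exact hanti k (k + 1) (by omega) h
        · obtain rfl : k = n := by omega
          rwa [hyL]
    have hsign : ∀ k ≤ n + 2, 0 < (-1 : ℝ) ^ k * (reducedDerangementPoly (n + 2)).eval (y k) := by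
      intro k hk
      rcases k with _ | k
      · rw [hy0, eval_zero_reducedDerangementPoly]
        norm_num
      · rcases Nat.lt_or_ge k (n + 1) with h | h
        · rw [hys k h]
          have hroot : (reducedDerangementPoly (n + 1)).eval (s k) = 0 := by
            rw [hs, eval_polyOfZeros]
            exact Finset.prod_eq_zero (Finset.mem_range.mpr h) (sub_self _)
          have hneg := hsneg k h
          -- Since `s k < 0`, both surviving terms have sign `(-1) ^ (k + 1)`.
          have h1 := mul_pos (mul_pos (neg_pos.mpr hneg) (by linarith : 0 < 1 - s k)) (hd k h)
          have h2 := mul_pos (mul_pos (neg_pos.mpr hneg)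
            (by positivity : (0 : ℝ) < (n : ℝ) + 3)) (he k h)
          rw [reducedDerangementPoly]
          simp only [eval_add, eval_mul, eval_sub, eval_X, eval_one, eval_C, hroot]
          rw [pow_succ]
          linarith
        · obtain rfl : k = n + 1 := by omega
          rwa [hyL]
    obtain ⟨t, ht, hpt⟩ := exists_polyOfZeros_of_alternating
      (reducedDerangementPoly_monic (n + 2)) (natDegree_reducedDerangementPoly (n + 2)) y hy hsign
    refine ⟨s, t, hs, hpt, ?_, fun i hi => ⟨?_, ?_⟩⟩
    · have := (ht 0 (by omega)).2
      rwa [hy0] at this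
    · have := (ht (i + 1) (by omega)).2
      rwa [hys i hi] at this
    · have := (ht i (by omega)).1
      rwa [hys i hi] at this

/-! ### Return to the derangement polynomials -/

theorem derangementPoly_zero : derangementPoly 0 = 1 := by
  simp [derangementPoly_eq_sum, exc_eq_sum]

theorem derangementPoly_one : derangementPoly 1 = 0 := by
  rw [derangementPoly_eq_sum]
  exact Finset.sum_eq_zero fun π _ => if_neg fun h => h 0 (Subsingleton.elim _ _)

theorem derangementPoly_add_two (n : ℕ) :
    derangementPoly (n + 2) = X * reducedDerangementPoly n := by
  induction n using Nat.twoStepInduction with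
  | zero =>
    rw [derangementPoly_recurrence, derangementPoly_one, derangementPoly_zero]
    simp [reducedDerangementPoly]
  | one =>
    rw [derangementPoly_recurrence, derangementPoly_recurrence, derangementPoly_one,
      derangementPoly_zero]
    simp [reducedDerangementPoly]
    ring
  | more n ih1 ih2 =>
    rw [derangementPoly_recurrence, ih1, ih2, reducedDerangementPoly]
    simp only [derivative_mul, derivative_X, C_add, map_natCast, map_ofNat]
    push_cast
    ring

theorem X_mul_polyOfZeros (r : ℕ → ℝ) (m : ℕ) :
    X * polyOfZeros r m = polyOfZeros (fun i => if i = 0 then 0 else r (i - 1)) (m + 1) := by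
  rw [polyOfZeros, polyOfZeros, Finset.prod_range_succ']
  simp [mul_comm]

theorem derangementPoly_interlaces (n : ℕ) :
    Interlaces (derangementPoly (n + 2)) (derangementPoly (n + 3)) := by
  obtain ⟨r, s, hr, hs, hs0, hrs⟩ := exists_interlacing_zeros n
  have hp := derangementPoly_add_two n
  have hq := derangementPoly_add_two (n + 1)
  rw [hr, X_mul_polyOfZeros] at hp
  rw [hs, X_mul_polyOfZeros] at hq
  set r' : ℕ → ℝ := fun i => if i = 0 then 0 else r (i - 1) with hr'
  set s' : ℕ → ℝ := fun i => if i = 0 then 0 else s (i - 1) with hs'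
  -- Index `0` is the common zero `0`, the only place where strictness fails.
  have hsr : ∀ i < n + 1, s' (i + 1) < r' i ∧ r' i ≤ s' i ∧ (i ≠ 0 → r' i < s' i) := by
    intro i hi
    rcases i with _ | i
    · simpa [hr', hs'] using hs0
    · have := hrs i (by omega)
      simp only [hr', hs', Nat.add_eq_zero_iff, one_ne_zero, and_false, if_false,
        Nat.add_sub_cancel]
      exact ⟨this.1, this.2.le, fun _ => this.2⟩
  have hra := lt_of_forall_succ_lt (s := r') (m := n + 1) fun i hi =>
    ((hsr (i + 1) hi).2.2 (by omega)).trans (hsr i (by omega)).1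
  have hsa := lt_of_forall_succ_lt (s := s') (m := n + 1 + 1) fun i hi =>
    (hsr i (by omega)).1.trans_le (hsr i (by omega)).2.1
  rw [hp, hq]
  refine ⟨(polyOfZeros_monic _ _).ne_zero, (polyOfZeros_monic _ _).ne_zero,
    hasOnlyRealZeros_polyOfZeros _ _, hasOnlyRealZeros_polyOfZeros _ _,
    by simp only [natDegree_polyOfZeros], fun i hi => ?_⟩
  rw [natDegree_polyOfZeros] at hi
  rw [nthZero_polyOfZeros hra hi, nthZero_polyOfZeros hsa (by omega),
    nthZero_polyOfZeros hsa (by omega)]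
  exact ⟨(hsr i hi).2.1, (hsr i hi).1.le⟩

theorem hasOnlyRealZeros_derangementPoly (n : ℕ) : HasOnlyRealZeros (derangementPoly n) := by
  match n with
  | 0 =>
    rw [derangementPoly_zero]
    exact Or.inr fun z hz => by simp at hz
  | 1 => exact Or.inl derangementPoly_one
  | n + 2 => exact (derangementPoly_interlaces n).2.2.1

theorem isStandard_derangementPoly (n : ℕ) : IsStandard (derangementPoly n) := by
  match n with
  | 0 => exact Or.inr (by simp [derangementPoly_zero])
  | 1 => exact Or.inl derangementPoly_one
  | n + 2 =>
    refine Or.inr ?_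
    rw [derangementPoly_add_two, (monic_X.mul (reducedDerangementPoly_monic n)).leadingCoeff]
    exact one_pos

theorem mainTheorem8 :
    (∀ n : ℕ, 2 ≤ n →
      derangementPoly n =
        ((n : ℝ[X]) - 1) * X * derangementPoly (n - 1)
          + X * (1 - X) * derivative (derangementPoly (n - 1))
          + ((n : ℝ[X]) - 1) * X * derangementPoly (n - 2)) ∧
    (∀ n : ℕ, 1 ≤ n → HasOnlyRealZeros (derangementPoly n)) ∧
    IsGeneralizedSturmSequence derangementPoly := by
  refine ⟨fun n hn => ?_, fun n _ => hasOnlyRealZeros_derangementPoly n,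
    isStandard_derangementPoly, hasOnlyRealZeros_derangementPoly, fun n => ?_⟩
  · obtain ⟨m, rfl⟩ : ∃ m, n = m + 2 := ⟨n - 2, by omega⟩
    have h : ((m + 2 : ℕ) : ℝ[X]) - 1 = (m : ℝ[X]) + 1 := by push_cast; ring
    rw [h]
    exact derangementPoly_recurrence m
  -- As `d_1 = 0`, the first two relations hold by convention.
  · match n with
    | 0 => exact Or.inr (Or.inr (Or.inr (Or.inl
        ⟨hasOnlyRealZeros_derangementPoly 0, derangementPoly_one⟩)))
    | 1 => exact Or.inr (Or.inr (Or.inr (Or.inr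
        ⟨derangementPoly_one, hasOnlyRealZeros_derangementPoly 2⟩)))
    | n + 2 => exact Or.inr (Or.inl (derangementPoly_interlaces n))
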